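/- Let $\alpha\in[0,1)$, let $\mu\in\mathbb R$ with $\mu\le\mu(\alpha):=\frac{(1-\alpha)^2}{4}$, and put $\nu=\frac{2}{2-\alpha}\sqrt{\mu(\alpha)-\mu}\ge 0$. Let $J_\nu$ be the Bessel function of the first kind of order $\nu$, and let $0<j_{\nu,1}<j_{\nu,2}<\cdots$ be its positive zeros in increasing order. For $k\ge1$ and $x\in[0,1]$ set $$\lambda_k=\Big(\frac{2-\alpha}{2}\Big)^2 j_{\nu,k}^2,\qquad \Phi_k(x)=\frac{\sqrt{2-\alpha}}{|J_\nu'(j_{\nu,k})|}\,x^{\frac{1-\alpha}{2}}J_\nu\big(j_{\nu,k}\,x^{\frac{2-\alpha}{2}}\big),$$ and let $$\mathcal P=\Big\{\Big(\frac{j_{\nu,k}}{j_{\nu,n}}\Big)^{\frac{2}{2-\alpha}} : n>k\ge1\Big\}.$$ Let $\overline b\in(0,1)$ with $\overline b\notin\mathcal P$. Then the quantity $$T^{(\alpha,\mu)}(\overline b)=\limsup_{k\to+\infty}-\frac{\log|\Phi_k(\overline b)|}{\lambda_k}$$ is well defined and belongs to $[0,+\infty]$. Here "well defined" means the following. The function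 $J_\nu$ has infinitely many positive zeros, and they can be listed as above, with none left out. For every $k\ge1$ one has $J_\nu'(j_{\nu,k})\ne0$, $\lambda_k>0$ and $\Phi_k(\overline b)\neq0$. Moreover, for every $k\ge 1$, $\Phi_k$ is an eigenfunction with eigenvalue $\lambda_k$ of the Dirichlet problem $$-(x^\alpha\Phi')'-\frac{\mu}{x^{2-\alpha}}\Phi=\lambda\Phi\ \text{ on }(0,1),\qquad \Phi(0)=\Phi(1)=0,$$ namely $\Phi_k$ is $C^2$ on $(0,1]$, satisfies the equation pointwise on $(0,1)$, tends to $0$ at $0$, vanishes at $1$, has unit norm in $L^2(0,1)$, and has finite energy, in the sense that $x^\alpha(\Phi_k')^2-\mu\,x^{\alpha-2}\Phi_k^2$ is integrable on $(0,1)$. -/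

import Mathlib

noncomputable section

namespace DegenerateSingular

/-- The Bessel function of the first kind `J_ν` (order `ν ≥ 0`, argument `x ≥ 0`):
`J_ν(x) = (x/2)^ν ∑_{m ≥ 0} (-1)^m / (m! Γ(m + ν + 1)) (x/2)^(2m)`. -/
def besselJ (ν x : ℝ) : ℝ :=
  (x / 2) ^ ν *
    ∑' m : ℕ, (-1 : ℝ) ^ m / ((m.factorial : ℝ) * Real.Gamma ((m : ℝ) + ν + 1)) *
      (x / 2) ^ (2 * m)

/-- `besselZero ν n` is the `n`-th positive zero `j_{ν,n}` of `J_ν` for `n ≥ 1`; each one is the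
smallest zero beyond the previous one. The search starts at the conventional value
`besselZero ν 0 = 0`, which is not one of the `j_{ν,n}`. -/
def besselZero (ν : ℝ) : ℕ → ℝ
  | 0 => 0
  | n + 1 => sInf {x : ℝ | besselZero ν n < x ∧ besselJ ν x = 0}

/-- The Hardy constant `μ(α) = (1 - α)² / 4`. -/
def hardyConst (α : ℝ) : ℝ := (1 - α) ^ 2 / 4

/-- The order `ν(α, μ) = 2 / (2 - α) * √(μ(α) - μ)`. -/
def besselOrder (α μ : ℝ) : ℝ := 2 / (2 - α) * Real.sqrt (hardyConst α - μ)

/-- The zeros `j_{ν(α,μ),n}`, `n ≥ 1`. -/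
def specZero (α μ : ℝ) (n : ℕ) : ℝ := besselZero (besselOrder α μ) n

/-- `λ_{α,μ,n} = ((2 - α) / 2)² (j_{ν(α,μ),n})²`. -/
def eigenvalue (α μ : ℝ) (n : ℕ) : ℝ := ((2 - α) / 2) ^ 2 * specZero α μ n ^ 2

/-- `Φ_{α,μ,n}(x) = √(2 - α) / |J_ν'(j_{ν,n})| * x^((1 - α)/2) * J_ν(j_{ν,n} x^((2 - α)/2))`
with `ν = ν(α, μ)`. -/
def eigenfunction (α μ : ℝ) (n : ℕ) (x : ℝ) : ℝ :=
  Real.sqrt (2 - α) / |deriv (besselJ (besselOrder α μ)) (specZero α μ n)| *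
    x ^ ((1 - α) / 2) * besselJ (besselOrder α μ) (specZero α μ n * x ^ ((2 - α) / 2))

/-- `φ` is an eigenfunction of unit norm in `L²(0,1)`, with eigenvalue `lam`, of the operator
`u ↦ -(x^α u')' - μ / x^(2-α) u` with Dirichlet conditions at `0` and `1`: it has finite energy,
and (being smooth in the interior) it solves the equation classically. -/
structure IsNormalizedEigenpair (α μ lam : ℝ) (φ : ℝ → ℝ) : Prop where
  contDiffOn : ContDiffOn ℝ 2 φ (Set.Ioc 0 1)
  integrable_sq : MeasureTheory.IntegrableOn (fun x => φ x ^ 2) (Set.Ioo 0 1)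
  norm_one : ∫ x in Set.Ioo (0 : ℝ) 1, φ x ^ 2 = 1
  energy : MeasureTheory.IntegrableOn
    (fun x => x ^ α * deriv φ x ^ 2 - μ * (φ x ^ 2 / x ^ (2 - α))) (Set.Ioo 0 1)
  left_zero : Filter.Tendsto φ (nhdsWithin 0 (Set.Ioi 0)) (nhds 0)
  right_zero : φ 1 = 0
  equation : ∀ x ∈ Set.Ioo (0 : ℝ) 1,
    -deriv (fun y => y ^ α * deriv φ y) x - μ / x ^ (2 - α) * φ x = lam * φ x

/-- The exceptional set `𝒫` of ratios `(j_{ν,k} / j_{ν,n})^(2/(2-α))`, `n > k ≥ 1`,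
with `ν = ν(α, μ)`. -/
def exceptionalSet (α μ : ℝ) : Set ℝ :=
  {x : ℝ | ∃ k n : ℕ, 1 ≤ k ∧ k < n ∧
    x = (specZero α μ k / specZero α μ n) ^ (2 / (2 - α))}

/-- `T^{(α,μ)}(b) = limsup_k -log |Φ_{α,μ,k}(b)| / λ_{α,μ,k}`, in the extended reals. -/
def minimalTime (α μ b : ℝ) : EReal :=
  Filter.limsup
    (fun k : ℕ => ((-(Real.log |eigenfunction α μ k b| / eigenvalue α μ k) : ℝ) : EReal))
    Filter.atTop

end DegenerateSingular

end

/-!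
Write `J = J_ν` and `D = x J'`. Bessel's equation is the system `x J' = D`, `x D' = (ν² - x²) J`; it
comes from the power series, differentiated term by term (`hasDerivAt_besselSeries`,
`besselSeries_ode`). Nearly everything follows from the energy `G = D² + (x² - ν²) J²`, which is
continuous on `[0, ∞)`, vanishes at `0`, and satisfies `G' = 2 x J² ≥ 0` (`hasDerivAt_besselEnergy`).

* `G > 0` on `(0, ∞)` (`besselEnergy_pos`), so the positive zeros of `J` are simple. Hence they are
  isolated, and as `J > 0` near `0`, each zero has a next one: `besselZero` lists them all
  (`exists_besselZero_eq`). That there are infinitely many is Sturm's comparison with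
  `sin (log x - t)` (`exists_besselJ_eq_zero`).
* Up to a constant, `Φ_k²` is the derivative of `x ↦ G (j_k x^((2-α)/2))`, so the `L²` norm is read
  off from `G (j_k) = (j_k J'(j_k))²` (`integral_besselProfile_sq`). The differential equation for
  `Φ_k` is the system above after the change of variable, and the energy density of `Φ_k` is an
  integrable power of `x` times a continuous function (`integrableOn_besselProfile_energy`).
* If `Φ_k(b) = 0` with `0 < b < 1`, then `j_k b^((2-α)/2)` is an earlier zero of `J`, that is,
  `b` lies in the exceptional set (`eigenfunction_ne_zero`).
* Since `G` increases, `j_k |J'(j_k)|` is bounded below; since `G / (x² - ν²)` decreases beyond `ν`,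
  `J` is bounded there (`exists_abs_besselJ_le`). So `|Φ_k(b)| = O(j_k)`, while `λ_k` is a multiple
  of `j_k²` and `j_k → ∞`. Thus `-log |Φ_k(b)| / λ_k` is bounded below by a sequence with limit `0`,
  and its upper limit is nonnegative (`minimalTime_nonneg`).
-/

namespace DegenerateSingular

/-! ### The power series of the Bessel function -/

/-- The Taylor coefficients of the entire function `y ↦ (√y)^(-ν) J_ν(2√y)`. -/
noncomputable def besselCoeff (ν : ℝ) (m : ℕ) : ℝ :=
  (-1 : ℝ) ^ m / ((m.factorial : ℝ) * Real.Gamma ((m : ℝ) + ν + 1))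

/-- The entire factor of the Bessel function: `J_ν(x) = (x/2)^ν * besselSeries ν ((x/2)²)`. -/
noncomputable def besselSeries (ν y : ℝ) : ℝ := ∑' m : ℕ, besselCoeff ν m * y ^ m

theorem besselJ_eq (ν x : ℝ) : besselJ ν x = (x / 2) ^ ν * besselSeries ν ((x / 2) ^ 2) := by
  simp only [besselJ, besselSeries, besselCoeff, pow_mul]

theorem factorial_mul_Gamma_le {ν : ℝ} (hν : 0 ≤ ν) (m : ℕ) :
    (m.factorial : ℝ) * Real.Gamma (ν + 1) ≤ Real.Gamma ((m : ℝ) + ν + 1) := by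
  induction m with
  | zero => simp
  | succ m ih =>
    have h : ((m + 1 : ℕ) : ℝ) + ν + 1 = ((m : ℝ) + ν + 1) + 1 := by push_cast; ring
    rw [h, Real.Gamma_add_one (s := (m : ℝ) + ν + 1) (by positivity), Nat.factorial_succ]
    have hG : 0 < Real.Gamma ((m : ℝ) + ν + 1) := Real.Gamma_pos_of_pos (by positivity)
    push_cast
    calc ((m : ℝ) + 1) * m.factorial * Real.Gamma (ν + 1)
        = ((m : ℝ) + 1) * (m.factorial * Real.Gamma (ν + 1)) := by ring
      _ ≤ (m + 1) * Real.Gamma ((m : ℝ) + ν + 1) := by gcongr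
      _ ≤ (m + ν + 1) * Real.Gamma ((m : ℝ) + ν + 1) := by gcongr; linarith

theorem abs_besselCoeff_le {ν : ℝ} (hν : 0 ≤ ν) (m : ℕ) :
    |besselCoeff ν m| ≤ (Real.Gamma (ν + 1))⁻¹ / m.factorial := by
  have h1 : 0 < Real.Gamma (ν + 1) := Real.Gamma_pos_of_pos (by positivity)
  have h2 := factorial_mul_Gamma_le hν m
  have hf : (1 : ℝ) ≤ m.factorial := by exact_mod_cast Nat.one_le_iff_ne_zero.2 m.factorial_ne_zero
  have h3 : Real.Gamma (ν + 1) ≤ Real.Gamma ((m : ℝ) + ν + 1) := by nlinarith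
  have h4 : 0 < Real.Gamma ((m : ℝ) + ν + 1) := h1.trans_le h3
  rw [besselCoeff, abs_div, abs_pow, abs_neg, abs_one, one_pow, abs_of_pos (by positivity),
    ← one_div, div_div, mul_comm (m.factorial : ℝ)]
  gcongr

theorem besselCoeff_succ (ν : ℝ) (m : ℕ) :
    besselCoeff ν (m + 1) * (m + 1) = -besselCoeff (ν + 1) m := by
  have hf : (m.factorial : ℝ) ≠ 0 := by exact_mod_cast m.factorial_ne_zero
  have hm : (m : ℝ) + 1 ≠ 0 := by positivity
  have h : ((m + 1 : ℕ) : ℝ) + ν + 1 = (m : ℝ) + (ν + 1) + 1 := by push_cast; ring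
  rw [besselCoeff, besselCoeff, h, Nat.factorial_succ, pow_succ]
  push_cast
  field_simp

theorem summable_besselSeries {ν : ℝ} (hν : 0 ≤ ν) (y : ℝ) :
    Summable fun m : ℕ => besselCoeff ν m * y ^ m := by
  refine Summable.of_norm_bounded ((Real.summable_pow_div_factorial |y|).mul_left
    (Real.Gamma (ν + 1))⁻¹) fun m => ?_
  rw [Real.norm_eq_abs, abs_mul, abs_pow]
  calc |besselCoeff ν m| * |y| ^ m ≤ (Real.Gamma (ν + 1))⁻¹ / m.factorial * |y| ^ m := by
        gcongr; exact abs_besselCoeff_le hν m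
    _ = _ := by ring

theorem hasDerivAt_besselSeries {ν : ℝ} (hν : 0 ≤ ν) (y : ℝ) :
    HasDerivAt (besselSeries ν) (-besselSeries (ν + 1) y) y := by
  have hG : 0 < Real.Gamma (ν + 1) := Real.Gamma_pos_of_pos (by positivity)
  set R : ℝ := |y| + 1 with hR
  have hy : y ∈ Metric.ball (0 : ℝ) R := by simp [hR]
  have hsum : Summable fun n : ℕ =>
      (Real.Gamma (ν + 1))⁻¹ / n.factorial * (n * R ^ (n - 1)) := by
    rw [← summable_nat_add_iff 1]
    refine ((Real.summable_pow_div_factorial R).mul_left (Real.Gamma (ν + 1))⁻¹).congr fun n => ?_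
    rw [Nat.factorial_succ, Nat.add_sub_cancel]
    have : (n.factorial : ℝ) ≠ 0 := by exact_mod_cast n.factorial_ne_zero
    push_cast
    field_simp
  have hbound : ∀ (n : ℕ), ∀ z ∈ Metric.ball (0 : ℝ) R,
      ‖besselCoeff ν n * (n * z ^ (n - 1))‖ ≤
        (Real.Gamma (ν + 1))⁻¹ / n.factorial * (n * R ^ (n - 1)) := by
    intro n z hz
    have hz' : |z| ≤ R := by simpa using (Metric.mem_ball.1 hz).le
    rw [Real.norm_eq_abs, abs_mul, abs_mul, abs_pow, Nat.abs_cast]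
    gcongr
    exact abs_besselCoeff_le hν n
  have key := hasDerivAt_tsum_of_isPreconnected hsum Metric.isOpen_ball
    (convex_ball (0 : ℝ) R).isPreconnected
    (fun n z _ => (hasDerivAt_pow n z).const_mul (besselCoeff ν n)) hbound hy
    (summable_besselSeries hν y) hy
  have hs : Summable fun n : ℕ => besselCoeff ν n * (n * y ^ (n - 1)) :=
    Summable.of_norm_bounded hsum fun n => hbound n y hy
  have hval : ∑' n : ℕ, besselCoeff ν n * (n * y ^ (n - 1)) = -besselSeries (ν + 1) y := by
    rw [hs.tsum_eq_zero_add, besselSeries, ← tsum_neg]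
    simp only [Nat.cast_zero, zero_mul, mul_zero, zero_add, Nat.add_sub_cancel]
    refine tsum_congr fun n => ?_
    rw [← neg_mul, ← besselCoeff_succ]
    push_cast
    ring
  rw [← hval]
  exact key

/-- Bessel's differential equation, written for the entire factor: since
`besselSeries ν` has derivative `-besselSeries (ν + 1)`, this is `y S'' + (ν + 1) S' + S = 0`. -/
theorem besselSeries_ode {ν : ℝ} (hν : 0 ≤ ν) (y : ℝ) :
    y * besselSeries (ν + 2) y - (ν + 1) * besselSeries (ν + 1) y + besselSeries ν y = 0 := by
  have h0 := summable_besselSeries hν y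
  have h1 := summable_besselSeries (ν := ν + 1) (by linarith) y
  have h2 := summable_besselSeries (ν := ν + 2) (by linarith) y
  have h1' : Summable fun m : ℕ => (m : ℝ) * (besselCoeff (ν + 1) m * y ^ m) := by
    rw [← summable_nat_add_iff 1]
    refine (h2.mul_left (-y)).congr fun m => ?_
    have := besselCoeff_succ (ν + 1) m
    rw [show ν + 1 + 1 = ν + 2 by ring] at this
    push_cast
    linear_combination (-y ^ (m + 1)) * this
  have e1 : y * besselSeries (ν + 2) y = -∑' m : ℕ, (m : ℝ) * (besselCoeff (ν + 1) m * y ^ m) := by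
    rw [h1'.tsum_eq_zero_add, besselSeries, ← tsum_mul_left, Nat.cast_zero, zero_mul, zero_add,
      ← tsum_neg]
    refine tsum_congr fun m => ?_
    have := besselCoeff_succ (ν + 1) m
    rw [show ν + 1 + 1 = ν + 2 by ring] at this
    push_cast
    linear_combination y ^ (m + 1) * this
  rw [e1, besselSeries, besselSeries, ← tsum_mul_left, ← tsum_neg,
    ← h1'.neg.tsum_sub (h1.mul_left _), ← (h1'.neg.sub (h1.mul_left _)).tsum_add h0]
  rw [show (0 : ℝ) = ∑' _ : ℕ, (0 : ℝ) by simp]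
  refine tsum_congr fun m => ?_
  have hG : 0 < Real.Gamma ((m : ℝ) + ν + 1) := Real.Gamma_pos_of_pos (by positivity)
  have hf : (m.factorial : ℝ) ≠ 0 := by exact_mod_cast m.factorial_ne_zero
  have hc : besselCoeff ν m = ((m : ℝ) + ν + 1) * besselCoeff (ν + 1) m := by
    have hp : (m : ℝ) + ν + 1 ≠ 0 := by positivity
    rw [besselCoeff, besselCoeff, ← add_assoc (m : ℝ) ν 1, Real.Gamma_add_one hp]
    field_simp
  rw [hc]
  ring

theorem contDiff_besselSeries (n : ℕ) {ν : ℝ} (hν : 0 ≤ ν) : ContDiff ℝ n (besselSeries ν) := by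
  induction n generalizing ν with
  | zero =>
    exact contDiff_zero.2 (continuous_iff_continuousAt.2 fun y =>
      (hasDerivAt_besselSeries hν y).continuousAt)
  | succ n ih =>
    rw [Nat.cast_succ]
    refine contDiff_succ_iff_deriv.2 ⟨fun y => (hasDerivAt_besselSeries hν y).differentiableAt,
      by simp, ?_⟩
    rw [funext fun y => (hasDerivAt_besselSeries hν y).deriv]
    exact (ih (by linarith)).neg

theorem continuous_besselSeries {ν : ℝ} (hν : 0 ≤ ν) : Continuous (besselSeries ν) :=
  (contDiff_besselSeries 0 hν).continuous

theorem besselSeries_zero_pos {ν : ℝ} (hν : 0 ≤ ν) : 0 < besselSeries ν 0 := by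
  have h1 : 0 < Real.Gamma (ν + 1) := Real.Gamma_pos_of_pos (by positivity)
  rw [besselSeries, tsum_eq_single 0 fun m hm => by simp [hm]]
  simpa [besselCoeff] using h1

/-! ### Bessel's equation as a first order system -/

/-- The Euler derivative `x J_ν'(x)` of the Bessel function, given by a formula which is continuous
at `0` as well. -/
noncomputable def besselEuler (ν x : ℝ) : ℝ :=
  (x / 2) ^ ν * (ν * besselSeries ν ((x / 2) ^ 2) -
    2 * (x / 2) ^ 2 * besselSeries (ν + 1) ((x / 2) ^ 2))

theorem continuous_besselJ {ν : ℝ} (hν : 0 ≤ ν) : Continuous (besselJ ν) := by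
  rw [funext (besselJ_eq ν)]
  have := continuous_besselSeries hν
  exact ((continuous_id.div_const 2).rpow_const fun _ => Or.inr hν).mul (by fun_prop)

theorem continuous_besselEuler {ν : ℝ} (hν : 0 ≤ ν) : Continuous (besselEuler ν) := by
  have := continuous_besselSeries hν
  have := continuous_besselSeries (ν := ν + 1) (by linarith)
  exact ((continuous_id.div_const 2).rpow_const fun _ => Or.inr hν).mul (by fun_prop)

theorem hasDerivAt_half_rpow (ν : ℝ) {x : ℝ} (hx : 0 < x) :
    HasDerivAt (fun x : ℝ => (x / 2) ^ ν) (ν * (x / 2) ^ ν / x) x := by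
  have h := ((hasDerivAt_id x).div_const 2).rpow_const (p := ν) (Or.inl (by simp [hx.ne']))
  refine h.congr_deriv ?_
  rw [id, Real.rpow_sub_one (by positivity)]
  field_simp

theorem hasDerivAt_besselSeries_sq {ν : ℝ} (hν : 0 ≤ ν) (x : ℝ) :
    HasDerivAt (fun x : ℝ => besselSeries ν ((x / 2) ^ 2))
      (-besselSeries (ν + 1) ((x / 2) ^ 2) * (x / 2)) x := by
  have h := (hasDerivAt_besselSeries hν ((x / 2) ^ 2)).comp x
    (((hasDerivAt_id x).div_const 2).pow 2)
  refine h.congr_deriv ?_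
  simp only [id, Nat.cast_ofNat, Nat.reduceSub, pow_one]
  ring

theorem hasDerivAt_besselJ {ν : ℝ} (hν : 0 ≤ ν) {x : ℝ} (hx : 0 < x) :
    HasDerivAt (besselJ ν) (besselEuler ν x / x) x := by
  rw [funext (besselJ_eq ν)]
  refine ((hasDerivAt_half_rpow ν hx).mul (hasDerivAt_besselSeries_sq hν x)).congr_deriv ?_
  rw [besselEuler]
  field_simp
  ring

theorem hasDerivAt_besselEuler {ν : ℝ} (hν : 0 ≤ ν) {x : ℝ} (hx : 0 < x) :
    HasDerivAt (besselEuler ν) ((ν ^ 2 - x ^ 2) * besselJ ν x / x) x := by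
  have hS := hasDerivAt_besselSeries_sq hν x
  have hS1 := hasDerivAt_besselSeries_sq (ν := ν + 1) (by linarith) x
  have hq : HasDerivAt (fun x : ℝ => 2 * (x / 2) ^ 2) x x := by
    refine ((((hasDerivAt_id x).div_const 2).pow 2).const_mul 2).congr_deriv ?_
    simp
    ring
  refine ((hasDerivAt_half_rpow ν hx).mul ((hS.const_mul ν).sub (hq.mul hS1))).congr_deriv ?_
  have hode := besselSeries_ode hν ((x / 2) ^ 2)
  rw [besselJ_eq, show ν + 1 + 1 = ν + 2 by ring]
  simp only [Pi.sub_apply, Pi.mul_apply]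
  generalize besselSeries (ν + 2) ((x / 2) ^ 2) = s₂ at hode ⊢
  generalize besselSeries (ν + 1) ((x / 2) ^ 2) = s₁ at hode ⊢
  generalize besselSeries ν ((x / 2) ^ 2) = s₀ at hode ⊢
  field_simp
  linear_combination (4 * x ^ 2) * hode

/-- The energy `(x J')² + (x² - ν²) J²`. Its derivative `2 x J²` is nonnegative. -/
noncomputable def besselEnergy (ν x : ℝ) : ℝ :=
  besselEuler ν x ^ 2 + (x ^ 2 - ν ^ 2) * besselJ ν x ^ 2

theorem continuous_besselEnergy {ν : ℝ} (hν : 0 ≤ ν) : Continuous (besselEnergy ν) := by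
  have := continuous_besselJ hν
  have := continuous_besselEuler hν
  unfold besselEnergy
  fun_prop

theorem besselEnergy_zero (ν : ℝ) : besselEnergy ν 0 = 0 := by
  rw [besselEnergy, besselEuler, besselJ_eq]
  ring

theorem hasDerivAt_besselEnergy {ν : ℝ} (hν : 0 ≤ ν) {x : ℝ} (hx : 0 < x) :
    HasDerivAt (besselEnergy ν) (2 * x * besselJ ν x ^ 2) x := by
  refine (((hasDerivAt_besselEuler hν hx).pow 2).add
    ((((hasDerivAt_id x).pow 2).sub_const (ν ^ 2)).mul
      ((hasDerivAt_besselJ hν hx).pow 2))).congr_deriv ?_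
  simp
  field_simp
  ring

theorem monotoneOn_besselEnergy {ν : ℝ} (hν : 0 ≤ ν) :
    MonotoneOn (besselEnergy ν) (Set.Ici 0) := by
  refine monotoneOn_of_hasDerivWithinAt_nonneg (convex_Ici 0)
    (continuous_besselEnergy hν).continuousOn (f' := fun x => 2 * x * besselJ ν x ^ 2) ?_ ?_
  · intro x hx
    rw [interior_Ici] at hx
    exact (hasDerivAt_besselEnergy hν hx).hasDerivWithinAt
  · intro x hx
    rw [interior_Ici, Set.mem_Ioi] at hx
    positivity

theorem exists_forall_besselJ_pos {ν : ℝ} (hν : 0 ≤ ν) :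
    ∃ δ > 0, ∀ x, 0 < x → x < δ → 0 < besselJ ν x := by
  have hc : Continuous fun x : ℝ => besselSeries ν ((x / 2) ^ 2) := by
    have := continuous_besselSeries hν
    fun_prop
  have h0 : 0 < besselSeries ν (((0 : ℝ) / 2) ^ 2) := by simpa using besselSeries_zero_pos hν
  obtain ⟨δ, hδ, h⟩ := Metric.eventually_nhds_iff.1 (hc.continuousAt.eventually_const_lt h0)
  refine ⟨δ, hδ, fun x hx hxδ => ?_⟩
  rw [besselJ_eq]
  exact mul_pos (Real.rpow_pos_of_pos (by positivity) _)
    (h (by simpa [abs_of_pos hx] using hxδ))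

/-- If the energy vanished at `x > 0`, it would vanish on `[0, x]`, being monotone, and then so
would its derivative `2 t J_ν(t)²`, although `J_ν` is positive near `0`. -/
theorem besselEnergy_pos {ν : ℝ} (hν : 0 ≤ ν) {x : ℝ} (hx : 0 < x) : 0 < besselEnergy ν x := by
  have hmono := monotoneOn_besselEnergy hν
  have hnonneg : ∀ t, 0 ≤ t → 0 ≤ besselEnergy ν t := fun t ht => by
    simpa [besselEnergy_zero] using hmono Set.self_mem_Ici ht ht
  refine (hnonneg x hx.le).lt_of_ne' fun h0 => ?_
  obtain ⟨δ, hδ, hpos⟩ := exists_forall_besselJ_pos hν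
  set t := min δ x / 2 with ht
  have hmin : 0 < min δ x := lt_min hδ hx
  have ht0 : 0 < t := by positivity
  have htδ : t < δ := by have := min_le_left δ x; linarith
  have htx : t < x := by have := min_le_right δ x; linarith
  have hloc : besselEnergy ν =ᶠ[nhds t] fun _ => 0 := by
    filter_upwards [Ioo_mem_nhds ht0 htx] with s hs
    exact le_antisymm (h0 ▸ hmono hs.1.le hx.le hs.2.le) (hnonneg s hs.1.le)
  have hd := (hasDerivAt_besselEnergy hν ht0).unique
    ((hasDerivAt_const t (0 : ℝ)).congr_of_eventuallyEq hloc)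
  have := hpos t ht0 htδ
  have : 0 < 2 * t * besselJ ν t ^ 2 := by positivity
  linarith

theorem deriv_besselJ_ne_zero {ν : ℝ} (hν : 0 ≤ ν) {x : ℝ} (hx : 0 < x) (h : besselJ ν x = 0) :
    deriv (besselJ ν) x ≠ 0 := by
  rw [(hasDerivAt_besselJ hν hx).deriv]
  have := besselEnergy_pos hν hx
  rw [besselEnergy, h] at this
  refine div_ne_zero (fun h0 => ?_) hx.ne'
  simp [h0] at this

/-- Beyond `ν`, the quotient of the energy by `x² - ν²` decreases, and it dominates `J_ν²`. -/
theorem exists_abs_besselJ_le {ν : ℝ} (hν : 0 ≤ ν) :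
    ∃ K > 0, ∀ x, ν + 1 ≤ x → |besselJ ν x| ≤ K := by
  have hden : ∀ x, ν + 1 ≤ x → 0 < x ^ 2 - ν ^ 2 := fun x hx => by nlinarith
  have hanti : AntitoneOn (fun x => besselEnergy ν x / (x ^ 2 - ν ^ 2)) (Set.Ici (ν + 1)) := by
    refine antitoneOn_of_hasDerivWithinAt_nonpos (convex_Ici _)
      (f' := fun x => -(2 * x * besselEuler ν x ^ 2) / (x ^ 2 - ν ^ 2) ^ 2) ?_ ?_ ?_
    · exact (continuous_besselEnergy hν).continuousOn.div (by fun_prop)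
        fun x hx => (hden x hx).ne'
    · intro x hx
      rw [interior_Ici, Set.mem_Ioi] at hx
      have hx0 : 0 < x := by linarith
      refine (((hasDerivAt_besselEnergy hν hx0).div
        (((hasDerivAt_id x).pow 2).sub_const (ν ^ 2)) (hden x hx.le).ne').congr_deriv
          ?_).hasDerivWithinAt
      simp [besselEnergy]
      ring
    · intro x hx
      rw [interior_Ici, Set.mem_Ioi] at hx
      have hx0 : 0 < x := by linarith
      exact div_nonpos_of_nonpos_of_nonneg (neg_nonpos.2 (by positivity)) (by positivity)
  refine ⟨√(besselEnergy ν (ν + 1) / ((ν + 1) ^ 2 - ν ^ 2)),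
    Real.sqrt_pos.2 (div_pos (besselEnergy_pos hν (by linarith)) (hden _ le_rfl)), fun x hx => ?_⟩
  refine Real.abs_le_sqrt (le_trans ?_ (hanti Set.self_mem_Ici hx hx))
  rw [le_div_iff₀ (hden x hx), besselEnergy]
  nlinarith [sq_nonneg (besselEuler ν x)]

/-! ### The zeros of the Bessel function -/

/-- Sturm comparison in the variable `log x`: there Bessel's equation reads
`y'' = -(x² - ν²) y`, which oscillates faster than `w'' = -w` once `x² ≥ ν² + 1`. The Wronskian
of `y` and `w = sin (log x - t)` is monotone over a half period of `w`, which a `y` without zeros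
excludes. -/
theorem exists_besselJ_eq_zero {ν : ℝ} (hν : 0 ≤ ν) (a : ℝ) : ∃ x, a < x ∧ besselJ ν x = 0 := by
  by_contra! hne
  set c : ℝ := max a (ν + 1) + 1 with hc
  have hca : a < c := by have := le_max_left a (ν + 1); linarith
  have hcν : ν + 1 < c := by have := le_max_right a (ν + 1); linarith
  have hc0 : 0 < c := by linarith
  set d : ℝ := c * Real.exp Real.pi with hd
  have hcd : c ≤ d := le_mul_of_one_le_right hc0.le (Real.one_le_exp Real.pi_pos.le)
  have hlogd : Real.log d - Real.log c = Real.pi := by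
    rw [hd, Real.log_mul hc0.ne' (Real.exp_pos _).ne', Real.log_exp]
    ring
  -- `e` has the constant sign of `J_ν` on `[c, d]`
  obtain ⟨e, hpos⟩ : ∃ e : ℝ, ∀ x ∈ Set.Icc c d, 0 < e * besselJ ν x := by
    have hcont := continuous_besselJ hν
    have hsame : ∀ x ∈ Set.Icc c d, 0 < besselJ ν c * besselJ ν x := by
      intro x hx
      by_contra! hle
      have hmem : (0 : ℝ) ∈ (fun y => besselJ ν c * besselJ ν y) '' Set.Icc c x :=
        intermediate_value_Icc' hx.1 (by fun_prop)
          ⟨hle, mul_self_nonneg _⟩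
      obtain ⟨z, hz, hz0⟩ := hmem
      rcases mul_eq_zero.1 hz0 with h | h
      · exact hne c hca h
      · exact hne z (hca.trans_le hz.1) h
    exact ⟨_, hsame⟩
  set W : ℝ → ℝ := fun x => e * (besselEuler ν x * Real.sin (Real.log x - Real.log c) -
    besselJ ν x * Real.cos (Real.log x - Real.log c)) with hW
  have hderiv : ∀ x, 0 < x → HasDerivAt W
      (e * (-(x ^ 2 - ν ^ 2 - 1) * besselJ ν x * Real.sin (Real.log x - Real.log c) / x)) x := by
    intro x hx
    have hl := (Real.hasDerivAt_log hx.ne').sub_const (Real.log c)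
    refine ((((hasDerivAt_besselEuler hν hx).mul hl.sin).sub
      ((hasDerivAt_besselJ hν hx).mul hl.cos)).const_mul e).congr_deriv ?_
    field_simp
    ring
  have hanti : AntitoneOn W (Set.Icc c d) := by
    refine antitoneOn_of_hasDerivWithinAt_nonpos (convex_Icc c d)
      (fun x hx => (hderiv x (hc0.trans_le hx.1)).continuousAt.continuousWithinAt)
      (fun x hx => (hderiv x (hc0.trans_le (interior_subset hx).1)).hasDerivWithinAt) ?_
    intro x hx
    have hx' := interior_subset hx
    have hx0 : 0 < x := hc0.trans_le hx'.1
    have h1 : 0 ≤ Real.sin (Real.log x - Real.log c) := by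
      refine Real.sin_nonneg_of_nonneg_of_le_pi
        (sub_nonneg.2 (Real.log_le_log hc0 hx'.1)) ?_
      rw [← hlogd]
      exact sub_le_sub_right (Real.log_le_log hx0 hx'.2) _
    have h2 : 0 ≤ x ^ 2 - ν ^ 2 - 1 := by nlinarith [hx'.1]
    have h3 := hpos x hx'
    have : 0 ≤ (x ^ 2 - ν ^ 2 - 1) * (e * besselJ ν x) *
        Real.sin (Real.log x - Real.log c) / x := by positivity
    linear_combination this
  have hWle := hanti (Set.left_mem_Icc.2 hcd) (Set.right_mem_Icc.2 hcd) hcd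
  simp only [hW, hlogd, sub_self, Real.sin_zero, Real.cos_zero, Real.sin_pi, Real.cos_pi] at hWle
  linarith [hpos c (Set.left_mem_Icc.2 hcd), hpos d (Set.right_mem_Icc.2 hcd)]

/-- No nonnegative point is a limit from the right of zeros: the positive zeros are simple, and
`J_ν` is positive near `0`. -/
theorem exists_forall_besselJ_ne_zero {ν : ℝ} (hν : 0 ≤ ν) {z : ℝ}
    (hz : z = 0 ∨ 0 < z ∧ besselJ ν z = 0) :
    ∃ w > z, ∀ x, z < x → x < w → besselJ ν x ≠ 0 := by
  rcases hz with rfl | ⟨hz, h0⟩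
  · obtain ⟨δ, hδ, h⟩ := exists_forall_besselJ_pos hν
    exact ⟨δ, hδ, fun x hx hxδ => (h x hx hxδ).ne'⟩
  · have hd := (hasDerivAt_besselJ hν hz)
    have hne := hd.eventually_ne (c := 0) (hd.deriv ▸ deriv_besselJ_ne_zero hν hz h0)
    have hr : ∀ᶠ x in nhdsWithin z (Set.Ioi z), besselJ ν x ≠ 0 :=
      hne.filter_mono (nhdsWithin_mono z fun x (hx : z < x) => hx.ne')
    obtain ⟨w, hw, h⟩ := mem_nhdsGT_iff_exists_Ioo_subset.1 hr
    exact ⟨w, hw, fun x hx hxw => h ⟨hx, hxw⟩⟩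

theorem besselZero_succ_spec {ν : ℝ} (hν : 0 ≤ ν) {n : ℕ}
    (hn : besselZero ν n = 0 ∨ 0 < besselZero ν n ∧ besselJ ν (besselZero ν n) = 0) :
    besselZero ν n < besselZero ν (n + 1) ∧ besselJ ν (besselZero ν (n + 1)) = 0 ∧
      ∀ x, besselZero ν n < x → besselJ ν x = 0 → besselZero ν (n + 1) ≤ x := by
  obtain ⟨w, hw, hfree⟩ := exists_forall_besselJ_ne_zero hν hn
  set s : Set ℝ := {x : ℝ | besselZero ν n < x ∧ besselJ ν x = 0} with hs
  have hs' : s = Set.Ici w ∩ besselJ ν ⁻¹' {0} := by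
    ext x
    constructor
    · rintro ⟨h1, h2⟩
      exact ⟨not_lt.1 fun h => hfree x h1 h h2, h2⟩
    · rintro ⟨h1, h2⟩
      exact ⟨hw.lt.trans_le h1, h2⟩
  have hclosed : IsClosed s := by
    rw [hs']
    exact isClosed_Ici.inter (isClosed_singleton.preimage (continuous_besselJ hν))
  have hbdd : BddBelow s := ⟨besselZero ν n, fun x hx => hx.1.le⟩
  have hmem : besselZero ν (n + 1) ∈ s := by
    rw [besselZero]
    exact hclosed.csInf_mem (exists_besselJ_eq_zero hν _) hbdd
  refine ⟨hmem.1, hmem.2, fun x hx h0 => ?_⟩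
  rw [besselZero]
  exact csInf_le hbdd ⟨hx, h0⟩

theorem besselZero_eq_zero_or {ν : ℝ} (hν : 0 ≤ ν) (n : ℕ) :
    besselZero ν n = 0 ∨ 0 < besselZero ν n ∧ besselJ ν (besselZero ν n) = 0 := by
  induction n with
  | zero => exact Or.inl rfl
  | succ n ih =>
    obtain ⟨h1, h2, -⟩ := besselZero_succ_spec hν ih
    refine Or.inr ⟨lt_of_le_of_lt ?_ h1, h2⟩
    rcases ih with h | h
    · exact h.ge
    · exact h.1.le

theorem strictMono_besselZero {ν : ℝ} (hν : 0 ≤ ν) : StrictMono (besselZero ν) :=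
  strictMono_nat_of_lt_succ fun n => (besselZero_succ_spec hν (besselZero_eq_zero_or hν n)).1

theorem besselZero_pos {ν : ℝ} (hν : 0 ≤ ν) {n : ℕ} (hn : 1 ≤ n) : 0 < besselZero ν n :=
  strictMono_besselZero hν (show 0 < n from hn)

theorem besselJ_besselZero {ν : ℝ} (hν : 0 ≤ ν) {n : ℕ} (hn : 1 ≤ n) :
    besselJ ν (besselZero ν n) = 0 := by
  rcases besselZero_eq_zero_or hν n with h | h
  · exact absurd h (besselZero_pos hν hn).ne'
  · exact h.2

/-- A finite limit of the increasing sequence of zeros would be a zero which is not isolated. -/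
theorem tendsto_besselZero {ν : ℝ} (hν : 0 ≤ ν) :
    Filter.Tendsto (besselZero ν) Filter.atTop Filter.atTop := by
  have hmono := strictMono_besselZero hν
  rcases tendsto_atTop_of_monotone hmono.monotone with h | ⟨l, hl⟩
  · exact h
  exfalso
  have hlt : ∀ n, besselZero ν n < l := fun n =>
    (hmono n.lt_succ_self).trans_le (hmono.monotone.ge_of_tendsto hl _)
  have hl0 : 0 < l := hlt 0
  have hzero : besselJ ν l = 0 := by
    refine tendsto_nhds_unique (((continuous_besselJ hν).tendsto l).comp hl)
      (tendsto_const_nhds.congr' ?_)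
    filter_upwards [Filter.eventually_ge_atTop 1] with n hn
    exact (besselJ_besselZero hν hn).symm
  have hd := hasDerivAt_besselJ hν hl0
  have hne := hd.eventually_ne (c := 0) (hd.deriv ▸ deriv_besselJ_ne_zero hν hl0 hzero)
  have hl' : Filter.Tendsto (besselZero ν) Filter.atTop (nhdsWithin l {l}ᶜ) :=
    tendsto_nhdsWithin_iff.2 ⟨hl, Filter.Eventually.of_forall fun n => (hlt n).ne⟩
  obtain ⟨n, hn, hn1⟩ := ((hl'.eventually hne).and (Filter.eventually_ge_atTop 1)).exists
  exact hn (besselJ_besselZero hν hn1)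

theorem exists_besselZero_eq {ν : ℝ} (hν : 0 ≤ ν) {x : ℝ} (hx : 0 < x) (h0 : besselJ ν x = 0) :
    ∃ n, 1 ≤ n ∧ besselZero ν n = x := by
  by_contra! hne
  have hlt : ∀ n, besselZero ν n < x := by
    intro n
    induction n with
    | zero => exact hx
    | succ n ih =>
      exact ((besselZero_succ_spec hν (besselZero_eq_zero_or hν n)).2.2 x ih h0).lt_of_ne
        (hne (n + 1) n.succ_pos)
  obtain ⟨n, hn⟩ := ((tendsto_besselZero hν).eventually_ge_atTop x).exists
  exact (hlt n).not_ge hn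

/-! ### The eigenfunctions -/

/-- The function `C x^((1-α)/2) J_ν(j x^((2-α)/2))`, with free parameters `ν`, `j` and `C`. -/
noncomputable def besselProfile (α ν j C x : ℝ) : ℝ :=
  C * x ^ ((1 - α) / 2) * besselJ ν (j * x ^ ((2 - α) / 2))

theorem rpow_sq_eq (α : ℝ) {x : ℝ} (hx : 0 < x) :
    (x ^ ((2 - α) / 2)) ^ 2 = x * (x ^ ((1 - α) / 2)) ^ 2 := by
  rw [show (2 - α) / 2 = 1 / 2 + (1 - α) / 2 by ring, Real.rpow_add hx, mul_pow,
    ← Real.sqrt_eq_rpow, Real.sq_sqrt hx.le]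

theorem rpow_two_sub_eq (α : ℝ) {x : ℝ} (hx : 0 < x) :
    x ^ (2 - α) = x * (x ^ ((1 - α) / 2)) ^ 2 := by
  rw [← rpow_sq_eq α hx, ← Real.rpow_mul_natCast hx.le]
  congr 1
  push_cast
  ring

theorem rpow_eq_div (α : ℝ) {x : ℝ} (hx : 0 < x) :
    x ^ α = x / (x ^ ((1 - α) / 2)) ^ 2 := by
  have ht : 0 < x ^ ((1 - α) / 2) := Real.rpow_pos_of_pos hx _
  have h := rpow_two_sub_eq α hx
  rw [Real.rpow_sub hx, Real.rpow_two, div_eq_iff (Real.rpow_pos_of_pos hx _).ne'] at h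
  rw [eq_div_iff (by positivity)]
  have : x * x = x * (x ^ α * (x ^ ((1 - α) / 2)) ^ 2) := by linear_combination h
  exact (mul_left_cancel₀ hx.ne' this).symm

theorem hasDerivAt_comp_mul_rpow {f : ℝ → ℝ} {a j p x : ℝ} (hj : 0 < j) (hx : 0 < x)
    (h : HasDerivAt f (a / (j * x ^ p)) (j * x ^ p)) :
    HasDerivAt (fun y => f (j * y ^ p)) (p * a / x) x := by
  have hz : HasDerivAt (fun y : ℝ => j * y ^ p) (j * (p * x ^ (p - 1))) x :=
    (Real.hasDerivAt_rpow_const (Or.inl hx.ne')).const_mul j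
  refine (h.comp x hz).congr_deriv ?_
  have hp : 0 < x ^ p := Real.rpow_pos_of_pos hx _
  rw [Real.rpow_sub_one hx.ne']
  field_simp

theorem hasDerivAt_besselProfile {α ν j x : ℝ} (C : ℝ) (hν : 0 ≤ ν) (hj : 0 < j) (hx : 0 < x) :
    HasDerivAt (besselProfile α ν j C)
      (C * x ^ ((1 - α) / 2) / x * ((1 - α) / 2 * besselJ ν (j * x ^ ((2 - α) / 2)) +
        (2 - α) / 2 * besselEuler ν (j * x ^ ((2 - α) / 2)))) x := by
  have hz : 0 < j * x ^ ((2 - α) / 2) := mul_pos hj (Real.rpow_pos_of_pos hx _)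
  refine (((Real.hasDerivAt_rpow_const (Or.inl hx.ne')).const_mul C).mul
    (hasDerivAt_comp_mul_rpow hj hx (hasDerivAt_besselJ hν hz))).congr_deriv ?_
  rw [Real.rpow_sub_one hx.ne']
  ring

theorem continuous_besselProfile {α ν : ℝ} (j C : ℝ) (hα : α < 1) (hν : 0 ≤ ν) :
    Continuous (besselProfile α ν j C) := by
  have h1 : Continuous fun x : ℝ => x ^ ((1 - α) / 2) :=
    continuous_id.rpow_const fun _ => Or.inr (by linarith)
  have h2 : Continuous fun x : ℝ => x ^ ((2 - α) / 2) :=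
    continuous_id.rpow_const fun _ => Or.inr (by linarith)
  have := continuous_besselJ hν
  unfold besselProfile
  fun_prop

theorem contDiffAt_besselJ {ν : ℝ} (hν : 0 ≤ ν) {x : ℝ} (hx : 0 < x) (n : ℕ) :
    ContDiffAt ℝ n (besselJ ν) x := by
  rw [funext (besselJ_eq ν)]
  have hS := contDiff_besselSeries n hν
  exact ((contDiffAt_id.div_const 2).rpow_const_of_ne (by simpa using hx.ne')).mul
    (hS.comp ((contDiff_id.div_const 2).pow 2)).contDiffAt

theorem contDiffOn_besselProfile {α ν j : ℝ} (C : ℝ) (hν : 0 ≤ ν) (hj : 0 < j) (n : ℕ) :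
    ContDiffOn ℝ n (besselProfile α ν j C) (Set.Ioi 0) := by
  intro x (hx : 0 < x)
  have hz : 0 < j * x ^ ((2 - α) / 2) := mul_pos hj (Real.rpow_pos_of_pos hx _)
  have h1 : ContDiffAt ℝ n (fun x : ℝ => C * x ^ ((1 - α) / 2)) x :=
    contDiffAt_const.mul (contDiffAt_id.rpow_const_of_ne hx.ne')
  have h2 : ContDiffAt ℝ n (fun x : ℝ => j * x ^ ((2 - α) / 2)) x :=
    contDiffAt_const.mul (contDiffAt_id.rpow_const_of_ne hx.ne')
  exact (h1.mul ((contDiffAt_besselJ hν hz n).comp x h2)).contDiffWithinAt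

theorem besselProfile_equation {α μ ν j : ℝ} (C : ℝ) (hν : 0 ≤ ν) (hj : 0 < j)
    (hμ : ((2 - α) / 2) ^ 2 * ν ^ 2 = ((1 - α) / 2) ^ 2 - μ) {x : ℝ} (hx : 0 < x) :
    -deriv (fun y => y ^ α * deriv (besselProfile α ν j C) y) x -
        μ / x ^ (2 - α) * besselProfile α ν j C x =
      (((2 - α) / 2) ^ 2 * j ^ 2) * besselProfile α ν j C x := by
  have hz : 0 < j * x ^ ((2 - α) / 2) := mul_pos hj (Real.rpow_pos_of_pos hx _)
  have hflux : (fun y => y ^ α * deriv (besselProfile α ν j C) y) =ᶠ[nhds x] fun y =>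
      C * y ^ (-((1 - α) / 2)) * ((1 - α) / 2 * besselJ ν (j * y ^ ((2 - α) / 2)) +
        (2 - α) / 2 * besselEuler ν (j * y ^ ((2 - α) / 2))) := by
    filter_upwards [Ioi_mem_nhds hx] with y (hy : 0 < y)
    have ht : 0 < y ^ ((1 - α) / 2) := Real.rpow_pos_of_pos hy _
    rw [(hasDerivAt_besselProfile C hν hj hy).deriv, rpow_eq_div α hy, Real.rpow_neg hy.le]
    field_simp
  have hJ := hasDerivAt_comp_mul_rpow hj hx (hasDerivAt_besselJ hν hz)
  have hD := hasDerivAt_comp_mul_rpow hj hx (hasDerivAt_besselEuler hν hz)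
  have hder := (((Real.hasDerivAt_rpow_const (p := -((1 - α) / 2)) (Or.inl hx.ne')).const_mul
    C).mul ((hJ.const_mul ((1 - α) / 2)).add (hD.const_mul ((2 - α) / 2))))
  rw [hflux.deriv_eq.trans hder.deriv]
  have hsq := rpow_sq_eq α hx
  have ht : 0 < x ^ ((1 - α) / 2) := Real.rpow_pos_of_pos hx _
  rw [rpow_two_sub_eq α hx, Real.rpow_sub_one hx.ne', Real.rpow_neg hx.le, besselProfile, mul_pow j,
    hsq]
  simp only [Pi.add_apply]
  generalize besselJ ν (j * x ^ ((2 - α) / 2)) = J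
  generalize besselEuler ν (j * x ^ ((2 - α) / 2)) = D
  generalize x ^ ((1 - α) / 2) = t at ht ⊢
  field_simp
  linear_combination (-4 * C * J) * hμ

/-- The square of a profile is the derivative of a multiple of `x ↦ G (j x^((2-α)/2))`, where `G` is
the energy of `J_ν`. -/
theorem integral_besselProfile_sq {α ν j C : ℝ} (hα : α < 1) (hν : 0 ≤ ν) (hj : 0 < j) :
    ∫ x in Set.Ioo (0 : ℝ) 1, besselProfile α ν j C x ^ 2 =
      C ^ 2 / ((2 - α) * j ^ 2) * besselEnergy ν j := by
  have hα2 : 0 < 2 - α := by linarith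
  have hrpow : Continuous fun x : ℝ => x ^ ((2 - α) / 2) :=
    continuous_id.rpow_const fun _ => Or.inr (by linarith)
  have hG := continuous_besselEnergy hν
  have hder : ∀ x ∈ Set.Ioo (0 : ℝ) 1, HasDerivAt
      (fun x => C ^ 2 / ((2 - α) * j ^ 2) * besselEnergy ν (j * x ^ ((2 - α) / 2)))
      (besselProfile α ν j C x ^ 2) x := by
    intro x hx
    have hz : 0 < j * x ^ ((2 - α) / 2) := mul_pos hj (Real.rpow_pos_of_pos hx.1 _)
    have h := hasDerivAt_besselEnergy hν hz
    rw [← mul_div_cancel_left₀ (2 * (j * x ^ ((2 - α) / 2)) *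
        besselJ ν (j * x ^ ((2 - α) / 2)) ^ 2) hz.ne'] at h
    refine ((hasDerivAt_comp_mul_rpow hj hx.1 h).const_mul _).congr_deriv ?_
    have hsq := rpow_sq_eq α hx.1
    have hx0 := hx.1
    rw [besselProfile]
    generalize besselJ ν (j * x ^ ((2 - α) / 2)) = J
    field_simp
    linear_combination (C ^ 2 * J ^ 2) * hsq
  rw [← MeasureTheory.integral_Ioc_eq_integral_Ioo, ← intervalIntegral.integral_of_le zero_le_one,
    intervalIntegral.integral_eq_sub_of_hasDerivAt_of_le zero_le_one
      (by fun_prop) hder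
      (((continuous_besselProfile j C hα hν).pow 2).intervalIntegrable 0 1),
    Real.one_rpow, Real.zero_rpow (by linarith), mul_one, mul_zero, besselEnergy_zero, mul_zero,
    sub_zero]

theorem integrableOn_rpow_mul {q : ℝ} (hq : -1 < q) {F : ℝ → ℝ} (hF : Continuous F) :
    MeasureTheory.IntegrableOn (fun x => x ^ q * F x) (Set.Ioo 0 1) := by
  have h := (intervalIntegral.intervalIntegrable_rpow' (a := 0) (b := 1) hq).mul_continuousOn
    hF.continuousOn
  exact ((intervalIntegrable_iff_integrableOn_Ioc_of_le zero_le_one).1 h).mono_set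
    Set.Ioo_subset_Ioc_self

/-- Near `0` each of the two terms of the energy density may behave like `x^(2r-1)`, where
`r = ν (2-α)/2`. This is integrable if `ν > 0`, while the leading terms cancel if `ν = 0`. -/
theorem integrableOn_besselProfile_energy {α μ ν j C : ℝ} (hα : α < 1) (hν : 0 ≤ ν) (hj : 0 < j)
    (hμ : ((2 - α) / 2) ^ 2 * ν ^ 2 = ((1 - α) / 2) ^ 2 - μ) :
    MeasureTheory.IntegrableOn (fun x => x ^ α * deriv (besselProfile α ν j C) x ^ 2 -
      μ * (besselProfile α ν j C x ^ 2 / x ^ (2 - α))) (Set.Ioo 0 1) := by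
  have hrpow : Continuous fun x : ℝ => x ^ ((2 - α) / 2) :=
    continuous_id.rpow_const fun _ => Or.inr (by linarith)
  have hS := continuous_besselSeries hν
  have hS1 := continuous_besselSeries (ν := ν + 1) (by linarith)
  set y : ℝ → ℝ := fun x => (j * x ^ ((2 - α) / 2) / 2) ^ 2 with hy
  have hyc : Continuous y := by fun_prop
  have hdens : ∀ x, 0 < x → x ^ α * deriv (besselProfile α ν j C) x ^ 2 -
      μ * (besselProfile α ν j C x ^ 2 / x ^ (2 - α)) =
      C ^ 2 / x * ((j * x ^ ((2 - α) / 2) / 2) ^ ν) ^ 2 *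
        ((2 - α) * ν * ((1 - α) / 2 + (2 - α) / 2 * ν) * besselSeries ν (y x) ^ 2 -
          2 * (2 - α) * ((1 - α) / 2 + (2 - α) / 2 * ν) * y x * besselSeries ν (y x) *
            besselSeries (ν + 1) (y x) +
          (2 - α) ^ 2 * y x ^ 2 * besselSeries (ν + 1) (y x) ^ 2) := by
    intro x hx
    have ht : 0 < x ^ ((1 - α) / 2) := Real.rpow_pos_of_pos hx _
    rw [(hasDerivAt_besselProfile C hν hj hx).deriv, rpow_eq_div α hx, rpow_two_sub_eq α hx,
      besselProfile, besselEuler, besselJ_eq]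
    simp only [hy]
    generalize besselSeries ν ((j * x ^ ((2 - α) / 2) / 2) ^ 2) = s₀
    generalize besselSeries (ν + 1) ((j * x ^ ((2 - α) / 2) / 2) ^ 2) = s₁
    generalize (j * x ^ ((2 - α) / 2) / 2) ^ ν = h
    generalize (j * x ^ ((2 - α) / 2) / 2) = z
    generalize x ^ ((1 - α) / 2) = t at ht ⊢
    field_simp
    linear_combination (-4 * C ^ 2 * h ^ 2 * s₀ ^ 2) * hμ
  rcases hν.eq_or_lt with h0 | hpos
  · -- for `ν = 0` the density has a factor `y / x`, which is `x ^ (1 - α)` up to a constant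
    refine (integrableOn_rpow_mul (q := 1 - α) (by linarith)
      (F := fun x => C ^ 2 * (j ^ 2 / 4) * (-2 * (2 - α) * ((1 - α) / 2) * besselSeries ν (y x) *
        besselSeries (ν + 1) (y x) + (2 - α) ^ 2 * y x * besselSeries (ν + 1) (y x) ^ 2))
      (by fun_prop)).congr_fun ?_ measurableSet_Ioo
    intro x hx
    have hx0 := hx.1
    have hyx : y x = x * (j ^ 2 / 4 * x ^ (1 - α)) := by
      have h1 : x ^ (2 - α) = x * x ^ (1 - α) := by
        rw [show 2 - α = 1 + (1 - α) by ring, Real.rpow_add hx0, Real.rpow_one]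
      rw [← mul_left_comm, ← h1, rpow_two_sub_eq α hx0, ← rpow_sq_eq α hx0]
      simp only [hy]
      ring
    beta_reduce
    rw [hdens x hx0, ← h0, Real.rpow_zero]
    generalize besselSeries 0 (y x) = s₀
    generalize besselSeries (0 + 1) (y x) = s₁
    have hfac : y x / x = j ^ 2 / 4 * x ^ (1 - α) := by
      rw [hyx]
      field_simp
    linear_combination (C ^ 2 * (-2 * (2 - α) * ((1 - α) / 2) * s₀ * s₁ +
      (2 - α) ^ 2 * y x * s₁ ^ 2)) * (-hfac)
  · refine (integrableOn_rpow_mul (q := (2 - α) * ν - 1) (by nlinarith)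
      (F := fun x => C ^ 2 * ((j / 2) ^ ν) ^ 2 *
        ((2 - α) * ν * ((1 - α) / 2 + (2 - α) / 2 * ν) * besselSeries ν (y x) ^ 2 -
          2 * (2 - α) * ((1 - α) / 2 + (2 - α) / 2 * ν) * y x * besselSeries ν (y x) *
            besselSeries (ν + 1) (y x) +
          (2 - α) ^ 2 * y x ^ 2 * besselSeries (ν + 1) (y x) ^ 2))
      (by fun_prop)).congr_fun ?_ measurableSet_Ioo
    intro x hx
    have hx0 := hx.1
    have hpow : ((j * x ^ ((2 - α) / 2) / 2) ^ ν) ^ 2 =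
        ((j / 2) ^ ν) ^ 2 * x ^ ((2 - α) * ν) := by
      rw [mul_div_right_comm, Real.mul_rpow (by positivity) (by positivity), mul_pow,
        ← Real.rpow_mul hx0.le, ← Real.rpow_mul_natCast hx0.le]
      congr 2
      push_cast
      ring
    beta_reduce
    rw [hdens x hx0, hpow, Real.rpow_sub_one hx0.ne']
    ring

theorem isNormalizedEigenpair_besselProfile {α μ ν j C : ℝ} (hα : α < 1) (hν : 0 ≤ ν)
    (hμ : ((2 - α) / 2) ^ 2 * ν ^ 2 = ((1 - α) / 2) ^ 2 - μ) (hj : 0 < j) (h0 : besselJ ν j = 0)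
    (hC : C ^ 2 * besselEuler ν j ^ 2 = (2 - α) * j ^ 2) :
    IsNormalizedEigenpair α μ (((2 - α) / 2) ^ 2 * j ^ 2) (besselProfile α ν j C) where
  contDiffOn := (contDiffOn_besselProfile C hν hj 2).mono Set.Ioc_subset_Ioi_self
  integrable_sq :=
    (((continuous_besselProfile j C hα hν).pow 2).integrableOn_Icc (a := 0) (b := 1)).mono_set
      Set.Ioo_subset_Icc_self
  norm_one := by
    have hα2 : 0 < 2 - α := by linarith
    rw [integral_besselProfile_sq hα hν hj, besselEnergy, h0]
    field_simp
    linear_combination hC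
  energy := integrableOn_besselProfile_energy hα hν hj hμ
  left_zero := by
    have h := (continuous_besselProfile j C hα hν).tendsto 0
    rw [besselProfile, Real.zero_rpow (by linarith), mul_zero, zero_mul] at h
    exact h.mono_left nhdsWithin_le_nhds
  right_zero := by simp [besselProfile, h0]
  equation := fun x hx => besselProfile_equation C hν hj hμ hx.1

theorem besselOrder_nonneg {α : ℝ} (hα : α < 1) (μ : ℝ) : 0 ≤ besselOrder α μ :=
  mul_nonneg (div_nonneg zero_le_two (by linarith)) (Real.sqrt_nonneg _)

theorem besselOrder_sq {α μ : ℝ} (hα : α < 1) (hμ : μ ≤ hardyConst α) :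
    ((2 - α) / 2) ^ 2 * besselOrder α μ ^ 2 = ((1 - α) / 2) ^ 2 - μ := by
  have hα2 : 2 - α ≠ 0 := by linarith
  rw [besselOrder, mul_pow, Real.sq_sqrt (sub_nonneg.2 hμ), hardyConst]
  field_simp
  ring

theorem deriv_besselJ_specZero {α μ : ℝ} (hα : α < 1) {n : ℕ} (hn : 1 ≤ n) :
    deriv (besselJ (besselOrder α μ)) (specZero α μ n) =
      besselEuler (besselOrder α μ) (specZero α μ n) / specZero α μ n :=
  (hasDerivAt_besselJ (besselOrder_nonneg hα μ)
    (besselZero_pos (besselOrder_nonneg hα μ) hn)).deriv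

theorem isNormalizedEigenpair_eigenfunction {α μ : ℝ} (hα : α < 1) (hμ : μ ≤ hardyConst α)
    {n : ℕ} (hn : 1 ≤ n) :
    IsNormalizedEigenpair α μ (eigenvalue α μ n) (eigenfunction α μ n) := by
  have hν := besselOrder_nonneg hα μ
  have hj : 0 < specZero α μ n := besselZero_pos hν hn
  have h0 : besselJ (besselOrder α μ) (specZero α μ n) = 0 := besselJ_besselZero hν hn
  refine isNormalizedEigenpair_besselProfile hα hν (besselOrder_sq hα hμ) hj h0 ?_
  have hd := deriv_besselJ_ne_zero hν hj h0
  have hE := deriv_besselJ_specZero (μ := μ) hα hn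
  rw [eq_div_iff hj.ne'] at hE
  rw [← hE, div_pow, sq_abs, Real.sq_sqrt (by linarith)]
  field_simp

theorem eigenvalue_pos {α μ : ℝ} (hα : α < 1) {n : ℕ} (hn : 1 ≤ n) : 0 < eigenvalue α μ n := by
  have hj : 0 < specZero α μ n := besselZero_pos (besselOrder_nonneg hα μ) hn
  have hα2 : 0 < 2 - α := by linarith
  rw [eigenvalue]
  positivity

/-- A zero of the `n`-th eigenfunction in `(0,1)` is `(j_k / j_n)^(2/(2-α))` for some `k < n`. -/
theorem eigenfunction_ne_zero {α μ b : ℝ} (hα : α < 1) (hb₀ : 0 < b) (hb₁ : b < 1)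
    (hb : b ∉ exceptionalSet α μ) {n : ℕ} (hn : 1 ≤ n) : eigenfunction α μ n b ≠ 0 := by
  have hν := besselOrder_nonneg hα μ
  have hj : 0 < specZero α μ n := besselZero_pos hν hn
  have hα2 : 0 < 2 - α := by linarith
  have hd := deriv_besselJ_ne_zero hν hj (besselJ_besselZero hν hn)
  have hbp : 0 < b ^ ((2 - α) / 2) := Real.rpow_pos_of_pos hb₀ _
  refine mul_ne_zero (mul_ne_zero (div_ne_zero (Real.sqrt_pos.2 hα2).ne' (abs_ne_zero.2 hd))
    (Real.rpow_pos_of_pos hb₀ _).ne') fun h0 => hb ?_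
  obtain ⟨k, hk, hkz⟩ := exists_besselZero_eq hν (mul_pos hj hbp) h0
  refine ⟨k, n, hk, (strictMono_besselZero hν).lt_iff_lt.1 ?_, ?_⟩
  · rw [hkz]
    exact mul_lt_of_lt_one_right hj (Real.rpow_lt_one hb₀.le hb₁ (by positivity))
  · rw [show specZero α μ k = specZero α μ n * b ^ ((2 - α) / 2) from hkz,
      mul_div_cancel_left₀ _ hj.ne', ← Real.rpow_mul hb₀.le]
    rw [show (2 - α) / 2 * (2 / (2 - α)) = 1 by field_simp, Real.rpow_one]

/-! ### The minimal time -/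

/-- The energy at a zero is `(j_k J'(j_k))²`, so its monotonicity bounds `j_k |J'(j_k)|` from
below, while `J_ν` is bounded. Hence `|Φ_k(b)| = O(j_k)`. -/
theorem exists_abs_eigenfunction_le {α μ b : ℝ} (hα : α < 1) (hb₀ : 0 < b) :
    ∃ M, ∀ᶠ k in Filter.atTop, |eigenfunction α μ k b| ≤ M * specZero α μ k := by
  have hν := besselOrder_nonneg hα μ
  obtain ⟨K, hK, hbound⟩ := exists_abs_besselJ_le hν
  have hbp : 0 < b ^ ((2 - α) / 2) := Real.rpow_pos_of_pos hb₀ _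
  have henergy : ∀ n, 1 ≤ n → besselEnergy (besselOrder α μ) (specZero α μ n) =
      besselEuler (besselOrder α μ) (specZero α μ n) ^ 2 := fun n hn => by
    rw [besselEnergy, specZero, besselJ_besselZero hν hn]
    ring
  set c := |besselEuler (besselOrder α μ) (specZero α μ 1)| with hc
  have hc0 : 0 < c := by
    have := besselEnergy_pos hν (besselZero_pos hν le_rfl)
    rw [← specZero, henergy 1 le_rfl] at this
    exact abs_pos.2 fun h => by simp [h] at this
  refine ⟨√(2 - α) / c * b ^ ((1 - α) / 2) * K, ?_⟩
  have hlim : Filter.Tendsto (fun k => specZero α μ k * b ^ ((2 - α) / 2)) Filter.atTop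
      Filter.atTop := (tendsto_besselZero hν).atTop_mul_const hbp
  filter_upwards [hlim.eventually_ge_atTop (besselOrder α μ + 1), Filter.eventually_ge_atTop 1]
    with k hk hk1
  have hj : 0 < specZero α μ k := besselZero_pos hν hk1
  have hle : c ≤ |besselEuler (besselOrder α μ) (specZero α μ k)| := by
    rw [hc, ← sq_le_sq, ← henergy k hk1, ← henergy 1 le_rfl]
    exact monotoneOn_besselEnergy hν (besselZero_pos hν le_rfl).le hj.le
      ((strictMono_besselZero hν).monotone hk1)
  rw [eigenfunction, deriv_besselJ_specZero hα hk1, abs_mul, abs_mul, abs_div, abs_abs, abs_div,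
    abs_of_pos hj, abs_of_nonneg (Real.sqrt_nonneg _), abs_of_nonneg (Real.rpow_nonneg hb₀.le _)]
  calc √(2 - α) / (|besselEuler (besselOrder α μ) (specZero α μ k)| / specZero α μ k) *
        b ^ ((1 - α) / 2) * |besselJ (besselOrder α μ) (specZero α μ k * b ^ ((2 - α) / 2))|
      ≤ √(2 - α) / (c / specZero α μ k) * b ^ ((1 - α) / 2) * K := by
        gcongr
        exact hbound _ hk
    _ = _ := by
        field_simp

theorem minimalTime_nonneg {α μ b : ℝ} (hα : α < 1) (hb₀ : 0 < b) : 0 ≤ minimalTime α μ b := by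
  have hν := besselOrder_nonneg hα μ
  have hα2 : 0 < 2 - α := by linarith
  obtain ⟨M, hM⟩ := exists_abs_eigenfunction_le (μ := μ) hα hb₀
  have hlim : Filter.Tendsto (fun k => ((-(M / ((2 - α) / 2) ^ 2 / specZero α μ k) : ℝ) : EReal))
      Filter.atTop (nhds 0) := by
    have h : Filter.Tendsto (fun k => -(M / ((2 - α) / 2) ^ 2 / specZero α μ k)) Filter.atTop
        (nhds 0) := by
      simpa [specZero] using ((tendsto_besselZero hν).const_div_atTop (M / ((2 - α) / 2) ^ 2)).neg
    simpa only [EReal.coe_zero] using EReal.tendsto_coe.2 h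
  rw [← hlim.limsup_eq]
  refine Filter.limsup_le_limsup ?_
  filter_upwards [hM, Filter.eventually_ge_atTop 1] with k hk hk1
  have hj : 0 < specZero α μ k := besselZero_pos hν hk1
  refine EReal.coe_le_coe_iff.2 (neg_le_neg ?_)
  rw [div_le_iff₀ (eigenvalue_pos hα hk1)]
  calc Real.log |eigenfunction α μ k b| ≤ |eigenfunction α μ k b| :=
        Real.log_le_self (abs_nonneg _)
    _ ≤ M * specZero α μ k := hk
    _ = _ := by
        rw [eigenvalue]
        field_simp

end DegenerateSingular

theorem mainTheorem3 (α μ b : ℝ) (hα₀ : 0 ≤ α) (hα₁ : α < 1)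
    (hμ : μ ≤ DegenerateSingular.hardyConst α) (hb₀ : 0 < b) (hb₁ : b < 1)
    (hb : b ∉ DegenerateSingular.exceptionalSet α μ) :
    -- the numbers `j_{ν,n}`, `n ≥ 1`, enumerate the positive zeros of `J_ν` increasingly
    (StrictMono (DegenerateSingular.specZero α μ) ∧
      DegenerateSingular.specZero α μ '' Set.Ici 1 =
        {x : ℝ | 0 < x ∧
          DegenerateSingular.besselJ (DegenerateSingular.besselOrder α μ) x = 0}) ∧
    -- every quotient and every logarithm in the definition of `T` makes sense
    (∀ k : ℕ, 1 ≤ k →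
      deriv (DegenerateSingular.besselJ (DegenerateSingular.besselOrder α μ))
          (DegenerateSingular.specZero α μ k) ≠ 0 ∧
      DegenerateSingular.IsNormalizedEigenpair α μ (DegenerateSingular.eigenvalue α μ k)
          (DegenerateSingular.eigenfunction α μ k) ∧
      0 < DegenerateSingular.eigenvalue α μ k ∧
      DegenerateSingular.eigenfunction α μ k b ≠ 0) ∧
    DegenerateSingular.minimalTime α μ b ∈ Set.Icc (0 : EReal) ⊤ := by
  open DegenerateSingular in
  have hν := besselOrder_nonneg hα₁ μ
  refine ⟨⟨strictMono_besselZero hν, Set.Subset.antisymm ?_ ?_⟩, fun k hk => ⟨?_, ?_, ?_, ?_⟩,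
    minimalTime_nonneg hα₁ hb₀, le_top⟩
  · rintro _ ⟨n, hn, rfl⟩
    exact ⟨besselZero_pos hν hn, besselJ_besselZero hν hn⟩
  · rintro x ⟨hx, h0⟩
    exact exists_besselZero_eq hν hx h0
  · exact deriv_besselJ_ne_zero hν (besselZero_pos hν hk) (besselJ_besselZero hν hk)
  · exact isNormalizedEigenpair_eigenfunction hα₁ hμ hk
  · exact eigenvalue_pos hα₁ hk
  · exact eigenfunction_ne_zero hα₁ hb₀ hb₁ hb hk
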